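/- Let $\mathcal P$ be the free algebra of real polynomials in two freely noncommuting variables $a,x$, with the involution ${}^T$ that is real linear, reverses words and fixes $a$ and $x$; $q\in\mathcal P$ is called symmetric if $q^T=q$. For $n\ge 1$ let $\mathbb S_n$ be the set of real symmetric $n\times n$ matrices; for $A,X\in\mathbb S_n$ let $q(A,X)$ be the matrix obtained by substituting $A$ for $a$ and $X$ for $x$. Let $r,f\in\mathbb R[x]$ be scalar polynomials in one variable, and put $$p(a,x)=r(x)\,a+a\,r(x)-2f(x)\in\mathcal P .$$ Suppose that (i) $r(0)=1$ and $f(0)=0$; (ii) the rational function $f r^{-1}$ is not constant; (iii) there exists $\varepsilon>0$ such that for each $n\ge 1$ and each $A\in\mathbb S_n$ the set $$\{X\in\mathbb S_n:\ p(A,X)\succ 0\ \text{ and }\ \|X\|<\varepsilon\}$$ is convex, where $\succ 0$ means positive definite and $\|\cdot\|$ is the operator norm. Then there exist a symmetric polynomial $\ell\in\mathcal P$ that is affine linear in $x$ (each word of $\ell$ contains $x$ at most once) and finitely many polynomials $s_1,\dots,s_N\in\mathcal P$ ($N\ge 0$), each linear, hence homogeneous of degree one, in $x$ and independent of $a$,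 such that $$p(a,x)=\ell(a,x)-\sum_{j=1}^N s_j(x)^T s_j(x).$$ In particular, $\deg f\le 2$. -/

import Mathlib

open Polynomial

/-- The two freely noncommuting symmetric variables `a` and `x`. -/
inductive NCVar where
  | a
  | x
  deriving DecidableEq

/-- Free (noncommutative) real polynomials in `a` and `x`. The involution is `star`: it is
real linear, reverses words and fixes both variables. -/
abbrev NCPoly : Type := FreeAlgebra ℝ NCVar

namespace NCPoly

/-- The variable `a` as a free polynomial. -/
def varA : NCPoly := FreeAlgebra.ι ℝ NCVar.a

/-- The variable `x` as a free polynomial. -/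
def varX : NCPoly := FreeAlgebra.ι ℝ NCVar.x

/-- The free polynomial consisting of the single word `w`. -/
def word (w : List NCVar) : NCPoly := (w.map (FreeAlgebra.ι ℝ)).prod

/-- The free polynomials that are affine linear in `x`: linear combinations of words in which `x`
occurs at most once (there is no restriction on the occurrences of `a`). -/
def affineInX : Submodule ℝ NCPoly :=
  Submodule.span ℝ {q | ∃ w : List NCVar, w.count NCVar.x ≤ 1 ∧ q = word w}

/-- The free polynomials that are linear (homogeneous of degree one) in `x`: linear combinations
of words in which `x` occurs exactly once. -/
def linearInX : Submodule ℝ NCPoly :=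
  Submodule.span ℝ {q | ∃ w : List NCVar, w.count NCVar.x = 1 ∧ q = word w}

/-- The free polynomials independent of `a`: linear combinations of words without `a`. -/
def indepOfA : Submodule ℝ NCPoly :=
  Submodule.span ℝ {q | ∃ w : List NCVar, NCVar.a ∉ w ∧ q = word w}

/-- Evaluation of a free polynomial at a pair `(A, X)` of `n × n` matrices. -/
noncomputable def eval {n : ℕ} (A X : Matrix (Fin n) (Fin n) ℝ) :
    NCPoly →ₐ[ℝ] Matrix (Fin n) (Fin n) ℝ :=
  FreeAlgebra.lift ℝ (fun v : NCVar => match v with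
    | NCVar.a => A
    | NCVar.x => X)

/-- The cross section at `A` of the positivity set of `p`: the real symmetric matrices `X`
(of the same size as `A`) with `p(A, X) ≻ 0`. -/
def crossSection (p : NCPoly) {n : ℕ} (A : Matrix (Fin n) (Fin n) ℝ) :
    Set (Matrix (Fin n) (Fin n) ℝ) :=
  {X | X.IsSymm ∧ (eval A X p).PosDef}

end NCPoly

/-- The open ball of radius `ε` about `0` in the real symmetric `n × n` matrices, with respect to
the operator norm on Euclidean space. -/
def symmBall (n : ℕ) (ε : ℝ) : Set (Matrix (Fin n) (Fin n) ℝ) :=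
  {X | X.IsSymm ∧ ‖Matrix.toEuclideanCLM (n := Fin n) (𝕜 := ℝ) X‖ < ε}

/-- The free polynomial `p(a, x) = r(x) a + a r(x) - 2 f(x)`. -/
noncomputable def slicePoly (r f : ℝ[X]) : NCPoly :=
  aeval NCPoly.varX r * NCPoly.varA + NCPoly.varA * aeval NCPoly.varX r
    - (2 : ℝ) • aeval NCPoly.varX f

/-! Take `X = diag(x)` with small entries and `A = diag(g)` with `g = f/r` at the nodes, so that
`p(A, X) = 0`. The derivative of `p(A, ·)` at `X` is Schur multiplication by `kap`. When no entry of
`kap` vanishes, a curve `X + tH + t²K` can be given any symmetric first and second order terms of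
`p`. Making the first order term `w wᵀ` and the second order term a small positive multiple of the
identity gives a curve inside the positivity set, once `A` is raised by `t³` so that `X` lies there
too. Convexity then forces the second derivative in the direction `H` to be nonpositive on the
orthogonal complement of `w` (`hess_nonpos`).

Letting one entry of `w` tend to infinity isolates one summand of that second derivative. After
denominators are cleared, what remains is a polynomial kernel `ker` that is nonnegative on all
weights annihilating `den` (`ker_sum_nonneg`). With enough nodes, the weights realise point
evaluation combined with extraction of the top coefficient (`kernel_top_coeff_nonneg`). The
resulting quadratic in `τ` must be nonnegative, so if its `τ²` coefficient vanishes then so does its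
linear one. This excludes `deg r ≥ 2` and `deg f ≥ 3`, and gives the `x²` coefficient of `f` its
sign (`degree_bounds`). What survives is visibly affine in `x` minus one square. -/

namespace NCSlice

/-! ### Divided differences of one-variable polynomials. -/

/-- The divided difference `(q - q(x)) / (X - x)` as a polynomial. -/
noncomputable def dq (q : ℝ[X]) (x : ℝ) : ℝ[X] := q /ₘ (X - C x)

lemma dq_spec (q : ℝ[X]) (x : ℝ) : (X - C x) * dq q x + C (q.eval x) = q := by
  have h := modByMonic_add_div q (X - C x)
  rw [modByMonic_X_sub_C_eq_C_eval, add_comm] at h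
  exact h

lemma dq_eq_of_eq {q u : ℝ[X]} {x c : ℝ} (h : (X - C x) * u + C c = q) : dq q x = u := by
  refine (div_modByMonic_unique u (C c) (monic_X_sub_C x) ⟨by rw [add_comm, h], ?_⟩).1
  rw [degree_X_sub_C]
  exact degree_C_lt

lemma dq_C (c x : ℝ) : dq (C c) x = 0 := dq_eq_of_eq (c := c) (by simp)

lemma dq_add (p q : ℝ[X]) (x : ℝ) : dq (p + q) x = dq p x + dq q x := by
  refine dq_eq_of_eq (c := p.eval x + q.eval x) ?_
  nth_rewrite 3 [← dq_spec p x]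
  nth_rewrite 3 [← dq_spec q x]
  rw [C_add]; ring

lemma dq_C_mul (c : ℝ) (q : ℝ[X]) (x : ℝ) : dq (C c * q) x = C c * dq q x := by
  refine dq_eq_of_eq (c := c * q.eval x) ?_
  nth_rewrite 3 [← dq_spec q x]
  rw [C_mul]; ring

lemma dq_sub_C_mul (p q : ℝ[X]) (c x : ℝ) : dq (p - C c * q) x = dq p x - C c * dq q x := by
  have h : p - C c * q = p + C (-c) * q := by rw [C_neg]; ring
  rw [h, dq_add, dq_C_mul, C_neg]; ring

lemma dq_mul_X (q : ℝ[X]) (x : ℝ) : dq (q * X) x = dq q x * X + C (q.eval x) := by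
  refine dq_eq_of_eq (c := q.eval x * x) ?_
  nth_rewrite 4 [← dq_spec q x]
  rw [C_mul]; ring

lemma sub_mul_eval_dq (q : ℝ[X]) (x y : ℝ) :
    (y - x) * (dq q x).eval y = q.eval y - q.eval x := by
  have h := congrArg (eval y) (dq_spec q x)
  simp only [eval_add, eval_mul, eval_sub, eval_X, eval_C] at h
  linarith

lemma eval_dq_comm (q : ℝ[X]) (x y : ℝ) : (dq q x).eval y = (dq q y).eval x := by
  rcases eq_or_ne x y with rfl | h
  · rfl
  · apply mul_left_cancel₀ (sub_ne_zero.2 h)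
    linarith [sub_mul_eval_dq q x y, sub_mul_eval_dq q y x]

lemma eval_dq_self (q : ℝ[X]) (x : ℝ) : (dq q x).eval x = (derivative q).eval x := by
  have h := congrArg (fun p => eval x (derivative p)) (dq_spec q x)
  simpa using h

lemma natDegree_dq (q : ℝ[X]) (x : ℝ) : (dq q x).natDegree = q.natDegree - 1 := by
  rw [dq, natDegree_divByMonic _ (monic_X_sub_C x), natDegree_X_sub_C]

lemma coeff_dq {q : ℝ[X]} {n : ℕ} (h : q.natDegree ≤ n + 1) (x : ℝ) :
    (dq q x).coeff n = q.coeff (n + 1) := by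
  have h1 := congrArg (fun p => p.coeff (n + 1)) (dq_spec q x)
  have h2 : (dq q x).coeff (n + 1) = 0 :=
    coeff_eq_zero_of_natDegree_lt (by rw [natDegree_dq]; omega)
  simpa [coeff_X_sub_C_mul, coeff_C, h2] using h1

/-! ### Second order Taylor expansion of matrix polynomials at a diagonal matrix. -/

variable {n : ℕ}

/-- The first derivative of `Y ↦ q(Y)` at `diagonal x` in the direction `H`. -/
noncomputable def D1 (x : Fin n → ℝ) (q : ℝ[X]) (H : Matrix (Fin n) (Fin n) ℝ) :
    Matrix (Fin n) (Fin n) ℝ :=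
  .of fun i j => (dq q (x i)).eval (x j) * H i j

/-- Half the second derivative of `Y ↦ q(Y)` at `diagonal x` in the direction `H`. -/
noncomputable def D2 (x : Fin n → ℝ) (q : ℝ[X]) (H : Matrix (Fin n) (Fin n) ℝ) :
    Matrix (Fin n) (Fin n) ℝ :=
  .of fun i j => ∑ k, (dq (dq q (x k)) (x i)).eval (x j) * (H i k * H k j)

lemma D1_add (x : Fin n → ℝ) (p q : ℝ[X]) (H) : D1 x (p + q) H = D1 x p H + D1 x q H := by
  ext i j; simp [D1, dq_add, add_mul]

lemma D2_add (x : Fin n → ℝ) (p q : ℝ[X]) (H) : D2 x (p + q) H = D2 x p H + D2 x q H := by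
  ext i j; simp [D2, dq_add, add_mul, Finset.sum_add_distrib]

lemma D1_C (x : Fin n → ℝ) (c : ℝ) (H) : D1 x (C c) H = 0 := by
  ext i j; simp [D1, dq_C]

lemma D2_C (x : Fin n → ℝ) (c : ℝ) (H) : D2 x (C c) H = 0 := by
  ext i j
  have h : dq 0 = 0 := by funext y; simpa using dq_C 0 y
  simp [D2, dq_C, h]

lemma D1_mul_X (x : Fin n → ℝ) (q : ℝ[X]) (H) :
    D1 x (q * X) H = D1 x q H * Matrix.diagonal x
      + Matrix.diagonal (fun i => q.eval (x i)) * H := by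
  ext i j
  simp [D1, dq_mul_X]
  ring

/-- Leibniz rule for the right factor `Y`, whose own second derivative is zero. It drives the
induction in `aeval_expansion`. -/
lemma D2_mul_X (x : Fin n → ℝ) (q : ℝ[X]) (H) :
    D2 x (q * X) H = D2 x q H * Matrix.diagonal x + D1 x q H * H := by
  ext i j
  rw [Matrix.add_apply, Matrix.mul_diagonal, Matrix.mul_apply]
  simp only [D2, D1, Matrix.of_apply, dq_mul_X, dq_add, dq_C, Finset.sum_mul,
    ← Finset.sum_add_distrib]
  refine Finset.sum_congr rfl fun k _ => ?_
  rw [eval_dq_comm q (x i) (x k)]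
  simp
  ring

lemma D2_smul (x : Fin n → ℝ) (q : ℝ[X]) (s : ℝ) (H) : D2 x q (s • H) = s ^ 2 • D2 x q H := by
  ext i j
  simp only [D2, Matrix.of_apply, Matrix.smul_apply, smul_eq_mul, Finset.mul_sum]
  exact Finset.sum_congr rfl fun k _ => by ring

lemma D2_symm {x : Fin n → ℝ} {q : ℝ[X]} {H : Matrix (Fin n) (Fin n) ℝ} (hH : H.IsSymm) :
    (D2 x q H).IsSymm := by
  ext i j
  simp only [D2, Matrix.transpose_apply, Matrix.of_apply]
  refine Finset.sum_congr rfl fun k _ => ?_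
  rw [eval_dq_comm, hH.apply i k, hH.apply k j]
  ring

/-- Second order Taylor expansion of a polynomial along a parabola starting at a diagonal
matrix. -/
lemma aeval_expansion (x : Fin n → ℝ) (H K : Matrix (Fin n) (Fin n) ℝ) (q : ℝ[X]) :
    ∃ E : ℝ → Matrix (Fin n) (Fin n) ℝ, Continuous E ∧ ∀ t : ℝ,
      aeval (Matrix.diagonal x + t • H + t ^ 2 • K) q =
        Matrix.diagonal (fun i => q.eval (x i)) + t • D1 x q H + t ^ 2 • (D2 x q H + D1 x q K)
          + t ^ 3 • E t := by
  induction q using Polynomial.induction_on with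
  | C c =>
    refine ⟨0, continuous_const, fun t => ?_⟩
    simp only [D1_C, D2_C, aeval_C, eval_C]
    ext i j
    simp [Matrix.algebraMap_matrix_apply, Matrix.diagonal_apply]
  | add p q hp hq =>
    obtain ⟨E, hE, h⟩ := hp
    obtain ⟨E', hE', h'⟩ := hq
    refine ⟨E + E', hE.add hE', fun t => ?_⟩
    have h3 : Matrix.diagonal (fun i => (p + q).eval (x i)) =
        Matrix.diagonal (fun i => p.eval (x i)) + Matrix.diagonal (fun i => q.eval (x i)) := by
      simp
    rw [map_add, h, h', h3, D1_add, D1_add, D2_add, Pi.add_apply]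
    module
  | monomial m a hq =>
    rw [pow_succ, ← mul_assoc]
    generalize C a * X ^ m = q at hq
    obtain ⟨E, hE, h⟩ := hq
    -- The new remainder collects every product of total order at least three in `t`.
    refine ⟨fun t => D1 x q H * K + (D2 x q H + D1 x q K) * H + t • ((D2 x q H + D1 x q K) * K)
      + E t * (Matrix.diagonal x + t • H + t ^ 2 • K), by fun_prop, fun t => ?_⟩
    have h3 : Matrix.diagonal (fun i => (q * X).eval (x i)) =
        Matrix.diagonal (fun i => q.eval (x i)) * Matrix.diagonal x := by simp
    rw [map_mul, aeval_X, h, h3, D1_mul_X, D1_mul_X, D2_mul_X]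
    simp only [add_mul, mul_add, smul_mul_assoc, mul_smul_comm, smul_add, smul_smul]
    module

lemma isSymm_aeval {Y : Matrix (Fin n) (Fin n) ℝ} (hY : Y.IsSymm) (q : ℝ[X]) :
    (aeval Y q).IsSymm := by
  induction q using Polynomial.induction_on with
  | C c => simp [Matrix.IsSymm, aeval_C, Matrix.algebraMap_eq_diagonal]
  | add p q hp hq => rw [map_add]; exact hp.add hq
  | monomial m a _ =>
    rw [map_mul, aeval_C, map_pow, aeval_X, ← Algebra.smul_def]
    exact (hY.pow _).smul a

/-! ### The second order necessary condition for convexity. -/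

open Filter Topology Matrix

variable {n : ℕ}

/-- The Schur multiplier of the derivative of `Y ↦ p(diagonal g, Y)` at `diagonal x`. -/
noncomputable def kap (r f : ℝ[X]) (x g : Fin n → ℝ) (i j : Fin n) : ℝ :=
  (dq r (x i)).eval (x j) * (g i + g j) - 2 * (dq f (x i)).eval (x j)

lemma kap_comm (r f : ℝ[X]) (x g : Fin n → ℝ) (i j : Fin n) :
    kap r f x g i j = kap r f x g j i := by
  rw [kap, kap, eval_dq_comm r, eval_dq_comm f, add_comm (g i)]

/-- Half the second derivative of `Y ↦ p(diagonal g, Y)` at `diagonal x`. -/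
noncomputable def hess (r f : ℝ[X]) (x g : Fin n → ℝ) (H : Matrix (Fin n) (Fin n) ℝ) :
    Matrix (Fin n) (Fin n) ℝ :=
  D2 x r H * diagonal g + diagonal g * D2 x r H - (2 : ℝ) • D2 x f H

lemma hess_smul (r f : ℝ[X]) (x g : Fin n → ℝ) (s : ℝ) (H) :
    hess r f x g (s • H) = s ^ 2 • hess r f x g H := by
  simp only [hess, D2_smul, smul_mul_assoc, mul_smul_comm, smul_sub, smul_add, smul_comm (2 : ℝ)]

lemma hess_apply (r f : ℝ[X]) (x g : Fin n → ℝ) (H) (i j : Fin n) :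
    hess r f x g H i j = ∑ k, ((dq (dq r (x k)) (x i)).eval (x j) * (g i + g j)
      - 2 * (dq (dq f (x k)) (x i)).eval (x j)) * (H i k * H k j) := by
  simp only [hess, D2, Matrix.sub_apply, Matrix.add_apply, mul_diagonal, diagonal_mul,
    Matrix.smul_apply, of_apply, smul_eq_mul, Finset.mul_sum, Finset.sum_mul,
    ← Finset.sum_add_distrib, ← Finset.sum_sub_distrib]
  exact Finset.sum_congr rfl fun k _ => by ring

lemma hess_symm (r f : ℝ[X]) (x g : Fin n → ℝ) {H : Matrix (Fin n) (Fin n) ℝ} (hH : H.IsSymm) :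
    (hess r f x g H).IsSymm := by
  simp only [hess, IsSymm, transpose_sub, transpose_add, transpose_mul, transpose_smul,
    diagonal_transpose, (D2_symm (x := x) hH).eq]
  rw [add_comm]

lemma eval_slicePoly (r f : ℝ[X]) (A Y : Matrix (Fin n) (Fin n) ℝ) :
    NCPoly.eval A Y (slicePoly r f) = aeval Y r * A + A * aeval Y r - (2 : ℝ) • aeval Y f := by
  have hx : NCPoly.eval A Y NCPoly.varX = Y := by simp [NCPoly.eval, NCPoly.varX]
  have ha : NCPoly.eval A Y NCPoly.varA = A := by simp [NCPoly.eval, NCPoly.varA]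
  have h (q : ℝ[X]) : NCPoly.eval A Y (aeval NCPoly.varX q) = aeval Y q := by
    rw [← aeval_algHom_apply, hx]
  simp [slicePoly, h, ha]

lemma eval_slicePoly_symm (r f : ℝ[X]) {A Y : Matrix (Fin n) (Fin n) ℝ} (hA : A.IsSymm)
    (hY : Y.IsSymm) : (NCPoly.eval A Y (slicePoly r f)).IsSymm := by
  rw [eval_slicePoly, IsSymm, transpose_sub, transpose_add, transpose_mul, transpose_mul,
    transpose_smul, (isSymm_aeval hY r).eq, (isSymm_aeval hY f).eq, hA.eq, add_comm]

/-- The hypothesis `hg` kills the constant term. The shift of `A` by `t³` is of higher order than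
the two terms displayed, so it only enters the remainder. -/
lemma slice_expansion (r f : ℝ[X]) (x g : Fin n → ℝ) (hg : ∀ i, g i * r.eval (x i) = f.eval (x i))
    (H K : Matrix (Fin n) (Fin n) ℝ) :
    ∃ G : ℝ → Matrix (Fin n) (Fin n) ℝ, Continuous G ∧ ∀ t : ℝ,
      NCPoly.eval (diagonal g + t ^ 3 • (1 : Matrix (Fin n) (Fin n) ℝ))
        (diagonal x + t • H + t ^ 2 • K) (slicePoly r f) =
        t • of (fun i j => kap r f x g i j * H i j)
          + t ^ 2 • (hess r f x g H + of (fun i j => kap r f x g i j * K i j)) + t ^ 3 • G t := by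
  obtain ⟨E, hE, h⟩ := aeval_expansion x H K r
  obtain ⟨E', hE', h'⟩ := aeval_expansion x H K f
  have hL (M : Matrix (Fin n) (Fin n) ℝ) : of (fun i j => kap r f x g i j * M i j) =
      D1 x r M * diagonal g + diagonal g * D1 x r M - (2 : ℝ) • D1 x f M := by
    ext i j
    simp only [D1, Matrix.sub_apply, Matrix.add_apply, mul_diagonal, diagonal_mul,
      Matrix.smul_apply, of_apply, smul_eq_mul, kap]
    ring
  have h0 : diagonal (fun i => r.eval (x i)) * diagonal g
      + diagonal g * diagonal (fun i => r.eval (x i))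
      - (2 : ℝ) • diagonal (fun i => f.eval (x i)) = 0 := by
    rw [diagonal_mul_diagonal, diagonal_mul_diagonal, diagonal_add, ← diagonal_smul, diagonal_sub]
    rw [← diagonal_zero]
    congr 1
    funext i
    simp only [Pi.smul_apply, smul_eq_mul, ← hg i]
    ring
  refine ⟨fun t => E t * diagonal g + diagonal g * E t - (2 : ℝ) • E' t
    + (2 : ℝ) • (diagonal (fun i => r.eval (x i)) + t • D1 x r H
      + t ^ 2 • (D2 x r H + D1 x r K) + t ^ 3 • E t), by fun_prop, fun t => ?_⟩
  rw [eval_slicePoly, h, h', hL, hL, hess]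
  have h1 := sub_eq_iff_eq_add.1 h0
  simp only [add_mul, mul_add, smul_mul_assoc, mul_smul_comm, smul_add, smul_smul, mul_one,
    one_mul]
  rw [← sub_eq_zero]
  have h2 := sub_eq_zero.2 h1
  rw [← h2]
  module

lemma abs_quadratic_le (E : Matrix (Fin n) (Fin n) ℝ) (u : Fin n → ℝ) :
    |u ⬝ᵥ E *ᵥ u| ≤ (∑ i, ∑ j, |E i j|) * (u ⬝ᵥ u) := by
  have hu (i : Fin n) : u i ^ 2 ≤ u ⬝ᵥ u := by
    rw [dotProduct, sq]
    exact Finset.single_le_sum (f := fun i => u i * u i) (fun j _ => mul_self_nonneg _)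
      (Finset.mem_univ i)
  have h : u ⬝ᵥ E *ᵥ u = ∑ i, ∑ j, u i * (E i j * u j) := by
    simp only [dotProduct, mulVec, Finset.mul_sum]
  rw [h, Finset.sum_mul]
  refine (Finset.abs_sum_le_sum_abs _ _).trans ?_
  refine Finset.sum_le_sum fun i _ => (Finset.abs_sum_le_sum_abs _ _).trans ?_
  rw [Finset.sum_mul]
  refine Finset.sum_le_sum fun j _ => ?_
  rw [abs_mul, abs_mul, mul_left_comm]
  refine mul_le_mul_of_nonneg_left ?_ (abs_nonneg _)
  have h1 := hu i
  have h2 := hu j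
  rw [← sq_abs] at h1 h2
  nlinarith [sq_nonneg (|u i| - |u j|)]

lemma aeval_diagonal (x : Fin n → ℝ) (q : ℝ[X]) :
    aeval (diagonal x) q = diagonal (fun i => q.eval (x i)) := by
  obtain ⟨E, -, h⟩ := aeval_expansion x 0 0 q
  simpa using h 0

lemma norm_toEuclideanCLM_diagonal_lt {x : Fin n → ℝ} {ε : ℝ} (hε : 0 < ε)
    (hx : ∀ i, |x i| < ε) : ‖toEuclideanCLM (n := Fin n) (𝕜 := ℝ) (diagonal x)‖ < ε := by
  have h := l2_opNorm_diagonal (𝕜 := ℝ) x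
  rw [l2_opNorm_def] at h
  exact h.trans_lt ((pi_norm_lt_iff hε).2 hx)

lemma eventually_mem_symmBall {ε : ℝ} {Y : ℝ → Matrix (Fin n) (Fin n) ℝ} (hY : Continuous Y)
    (hs : ∀ t, (Y t).IsSymm) (h0 : Y 0 ∈ symmBall n ε) : ∀ᶠ t in 𝓝[>] 0, Y t ∈ symmBall n ε := by
  have hc : Continuous fun M : Matrix (Fin n) (Fin n) ℝ =>
      toEuclideanCLM (n := Fin n) (𝕜 := ℝ) M :=
    (IsLinearMap.mk' (toEuclideanCLM (n := Fin n) (𝕜 := ℝ))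
      ⟨map_add _, map_smul _⟩).continuous_of_finiteDimensional
  have h := (hc.comp hY).norm.tendsto 0 |>.eventually_lt_const h0.2
  filter_upwards [h.filter_mono nhdsWithin_le_nhds] with t ht
  exact ⟨hs t, ht⟩

lemma eventually_mul_lt {G : ℝ → Matrix (Fin n) (Fin n) ℝ} (hG : Continuous G) (c : ℝ) {θ : ℝ}
    (hθ : 0 < θ) : ∀ᶠ t in 𝓝[>] 0, t * (∑ i, ∑ j, |G t i j|) * c < θ := by
  have h : Continuous fun t => t * (∑ i, ∑ j, |G t i j|) * c := by
    have (i j : Fin n) : Continuous fun t => G t i j := hG.matrix_elem i j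
    fun_prop
  exact ((h.tendsto 0).eventually_lt_const (by simpa using hθ)).filter_mono nhdsWithin_le_nhds

/-- The second order necessary condition for convexity at a pair with `p = 0`. -/
lemma hess_nonpos (r f : ℝ[X]) {ε : ℝ}
    (hconv : ∀ A : Matrix (Fin n) (Fin n) ℝ, A.IsSymm →
      Convex ℝ (NCPoly.crossSection (slicePoly r f) A ∩ symmBall n ε))
    (x g w v : Fin n → ℝ) (hg : ∀ i, g i * r.eval (x i) = f.eval (x i))
    (hε : 0 < ε) (hx : ∀ i, |x i| < ε) (hr : ∀ i, 0 < r.eval (x i))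
    (hk : ∀ i j, kap r f x g i j ≠ 0) (hwv : w ⬝ᵥ v = 0) :
    v ⬝ᵥ hess r f x g (of fun i j => w i * w j / kap r f x g i j) *ᵥ v ≤ 0 := by
  set H : Matrix (Fin n) (Fin n) ℝ := of fun i j => w i * w j / kap r f x g i j with hH
  by_contra! hb
  set b := v ⬝ᵥ hess r f x g H *ᵥ v with hbdef
  have hv : 0 < v ⬝ᵥ v := by
    rcases eq_or_ne v 0 with rfl | h
    · simp at hbdef; simp [hbdef] at hb
    · simpa using dotProduct_star_self_pos_iff.2 h
  -- Any positive `θ` keeps the curve in the positivity set; this one is small enough that the point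
  -- a quarter of the way along the chord fails positivity on `v`.
  obtain ⟨θ, hθ, hθb⟩ : ∃ θ : ℝ, 0 < θ ∧ θ * (v ⬝ᵥ v) = b / 2 :=
    ⟨b / 2 / (v ⬝ᵥ v), by positivity, by field_simp⟩
  -- `K` cancels the second derivative in the direction `H`, so that the `t²` term along the curve
  -- is `θ • 1`.
  set K : Matrix (Fin n) (Fin n) ℝ :=
    of fun i j => ((θ • (1 : Matrix (Fin n) (Fin n) ℝ)) i j - hess r f x g H i j)
      / kap r f x g i j with hK
  have hHs : H.IsSymm := by
    ext i j
    simp only [hH, transpose_apply, of_apply]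
    rw [kap_comm, mul_comm]
  have hKs : K.IsSymm := by
    ext i j
    simp only [hK, transpose_apply, of_apply]
    rw [kap_comm, (hess_symm r f x g hHs).apply i j, ((isSymm_one (n := Fin n) (α := ℝ)).smul θ).apply i j]
  have hLH : of (fun i j => kap r f x g i j * H i j) = vecMulVec w w := by
    ext i j
    simp only [hH, of_apply, vecMulVec_apply]
    field_simp [hk i j]
  have hLK : of (fun i j => kap r f x g i j * K i j)
      = θ • (1 : Matrix (Fin n) (Fin n) ℝ) - hess r f x g H := by
    ext i j
    simp only [hK, of_apply, Matrix.sub_apply]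
    field_simp [hk i j]
  obtain ⟨G, hG, hGe⟩ := slice_expansion r f x g hg H K
  -- The chord point scales both `H` and `K` by 1/4, while the term quadratic in `H` scales by 1/16;
  -- the cancellation arranged by `K` is thereby destroyed.
  obtain ⟨G', hG', hGe'⟩ := slice_expansion r f x g hg ((1 / 4 : ℝ) • H) ((1 / 4 : ℝ) • K)
  have hsmul (M : Matrix (Fin n) (Fin n) ℝ) :
      of (fun i j => kap r f x g i j * ((1 / 4 : ℝ) • M) i j)
        = (1 / 4 : ℝ) • of (fun i j => kap r f x g i j * M i j) := by
    ext i j; simp only [of_apply, Matrix.smul_apply, smul_eq_mul]; ring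
  rw [hLH, hLK] at hGe
  rw [hsmul, hsmul, hLH, hLK, hess_smul] at hGe'
  set Y : ℝ → Matrix (Fin n) (Fin n) ℝ := fun t => diagonal x + t • H + t ^ 2 • K with hY
  have hds : (diagonal x).IsSymm := isSymm_diagonal x
  have hYs (t : ℝ) : (Y t).IsSymm := (hds.add (hHs.smul t)).add (hKs.smul _)
  have hX : diagonal x ∈ symmBall n ε := ⟨hds, norm_toEuclideanCLM_diagonal_lt hε hx⟩
  have e1 := eventually_mem_symmBall (ε := ε) (by fun_prop : Continuous Y) hYs (by simpa [hY] using hX)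
  obtain ⟨t, ht, hball, h1, h2⟩ := (eventually_mem_nhdsWithin.and (e1.and
    ((eventually_mul_lt hG 1 hθ).and
      (eventually_mul_lt hG' (v ⬝ᵥ v) (by positivity : 0 < b / 16))))).exists
  have ht : 0 < t := ht
  set A : Matrix (Fin n) (Fin n) ℝ := diagonal g + t ^ 3 • (1 : Matrix (Fin n) (Fin n) ℝ) with hA
  have hAs : A.IsSymm := (isSymm_diagonal g).add (isSymm_one.smul _)
  have hXmem : diagonal x ∈ NCPoly.crossSection (slicePoly r f) A := by
    refine ⟨hds, ?_⟩
    have h : NCPoly.eval A (diagonal x) (slicePoly r f)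
        = diagonal (fun i => 2 * t ^ 3 * r.eval (x i)) := by
      rw [eval_slicePoly, aeval_diagonal, aeval_diagonal]
      ext i j
      simp only [hA, Matrix.sub_apply, Matrix.add_apply, mul_diagonal, mul_add,
        add_mul, mul_smul_comm, smul_mul_assoc, mul_one, one_mul,
        Matrix.smul_apply, smul_eq_mul]
      rcases eq_or_ne i j with rfl | hij
      · simp only [diagonal_apply_eq, ← hg i]; ring
      · simp [diagonal_apply_ne _ hij]
    rw [h]
    exact PosDef.diagonal fun i => by have := hr i; positivity
  have hYmem : Y t ∈ NCPoly.crossSection (slicePoly r f) A := by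
    refine ⟨hYs t, PosDef.of_dotProduct_mulVec_pos ?_ fun u hu => ?_⟩
    · have := eval_slicePoly_symm r f hAs (hYs t)
      rwa [IsHermitian, conjTranspose_eq_transpose_of_trivial]
    · have hu' : 0 < u ⬝ᵥ u := by simpa using dotProduct_star_self_pos_iff.2 hu
      rw [hY, hA, hGe t]
      simp only [star_trivial, add_sub_cancel, add_mulVec, smul_mulVec, one_mulVec,
        dotProduct_add, dotProduct_smul, smul_eq_mul, vecMulVec_mulVec, op_smul_eq_smul]
      have hq := abs_le.1 (abs_quadratic_le (G t) u)
      have h3 : 0 ≤ t * (w ⬝ᵥ u * (u ⬝ᵥ w)) := by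
        rw [dotProduct_comm u w]; exact mul_nonneg ht.le (mul_self_nonneg _)
      have h4 : t * (∑ i, ∑ j, |G t i j|) * (u ⬝ᵥ u) < θ * (u ⬝ᵥ u) :=
        mul_lt_mul_of_pos_right (by linarith) hu'
      have h5 : -((t * (∑ i, ∑ j, |G t i j|) * (u ⬝ᵥ u))) ≤ t * (u ⬝ᵥ G t *ᵥ u) := by
        have := mul_le_mul_of_nonneg_left hq.1 ht.le
        linarith
      have h6 : 0 < t ^ 2 * (θ * (u ⬝ᵥ u) + t * (u ⬝ᵥ G t *ᵥ u)) :=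
        mul_pos (by positivity) (by linarith)
      linarith
  have hZ := hconv A hAs ⟨hXmem, hX⟩ ⟨hYmem, hball⟩ (by norm_num : (0 : ℝ) ≤ 3 / 4)
    (by norm_num : (0 : ℝ) ≤ 1 / 4) (by norm_num)
  have hZe : (3 / 4 : ℝ) • diagonal x + (1 / 4 : ℝ) • Y t
      = diagonal x + t • (1 / 4 : ℝ) • H + t ^ 2 • (1 / 4 : ℝ) • K := by
    rw [hY]; module
  have hpos := hZ.1.2.dotProduct_mulVec_pos (x := v) (by rintro rfl; simp at hv)
  -- On `v ⟂ w` the `t` term drops out and the `t²` coefficient is `b/16 + (b/2 - b)/4 = -b/16`,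
  -- which dominates the remainder.
  rw [hZe, hA, hGe' t] at hpos
  simp only [star_trivial, add_mulVec, sub_mulVec, smul_mulVec, one_mulVec,
    dotProduct_add, dotProduct_sub, dotProduct_smul, smul_eq_mul, vecMulVec_mulVec,
    op_smul_eq_smul, hwv, ← hbdef, hθb] at hpos
  have hq := (abs_le.1 (abs_quadratic_le (G' t) v)).2
  have h5 := mul_le_mul_of_nonneg_left hq ht.le
  have h6 : 0 < t ^ 2 * (b / 16 - t * (v ⬝ᵥ G' t *ᵥ v)) :=
    mul_pos (by positivity) (by linarith)
  linarith

end NCSlice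

/-! ### Reduction to a positive polynomial kernel. -/

namespace NCSlice

open Matrix

variable {n : ℕ}

/-- The kernel (a polynomial in `y` for each `x`) whose positivity encodes `hess_nonpos`. -/
noncomputable def ker (r F : ℝ[X]) (z x : ℝ) : ℝ[X] :=
  C (2 * r.eval x) * (r * dq (dq F z) x)
    - dq (dq r z) x * (C (F.eval x) * r + C (r.eval x) * F)

lemma ker_comm (r F : ℝ[X]) (z x y : ℝ) : (ker r F z x).eval y = (ker r F z y).eval x := by
  simp only [ker, eval_sub, eval_add, eval_mul, eval_C]
  rw [eval_dq_comm (dq F z), eval_dq_comm (dq r z)]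
  ring

/-- The polynomial that the functionals testing `ker` have to annihilate. -/
noncomputable def den (r F : ℝ[X]) (z : ℝ) : ℝ[X] := (r + C (r.eval z)) * dq F z

/-- Subtracting `g j` times `r` from `f` makes the numerator vanish at `x j`, so the multiplier
factors. Its nonvanishing can be read off the factors, and its denominators in `hess_nonpos` are
cleared by values of one polynomial. -/
lemma kap_mul (r f : ℝ[X]) (x g : Fin n → ℝ) (hg : ∀ i, g i * r.eval (x i) = f.eval (x i))
    (i j : Fin n) :
    r.eval (x i) * kap r f x g i j = -(den r (f - C (g j) * r) (x j)).eval (x i) := by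
  have h1 := sub_mul_eval_dq r (x j) (x i)
  have h2 := sub_mul_eval_dq f (x j) (x i)
  rw [← hg, ← hg] at h2
  have h3 := hg i
  simp only [den, dq_sub_C_mul, eval_mul, eval_add, eval_sub, eval_C, kap]
  rw [eval_dq_comm r (x i), eval_dq_comm f (x i)]
  linear_combination (-(dq r (x j)).eval (x i)) * h2 + ((dq f (x j)).eval (x i)) * h1

lemma ker_eval (r f : ℝ[X]) (x g : Fin n → ℝ) (hg : ∀ i, g i * r.eval (x i) = f.eval (x i))
    (k i j : Fin n) :
    (ker r (f - C (g k) * r) (x k) (x i)).eval (x j) =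
      -(r.eval (x i) * r.eval (x j) * ((dq (dq r (x k)) (x i)).eval (x j) * (g i + g j)
        - 2 * (dq (dq f (x k)) (x i)).eval (x j))) := by
  simp only [ker, dq_sub_C_mul, eval_mul, eval_add, eval_sub, eval_C, ← hg]
  ring

lemma cancel_weights {u v κ κ' : ℝ} (a b T w : ℝ) (hu : u ≠ 0) (hv : v ≠ 0) (hκ : κ ≠ 0)
    (hκ' : κ' ≠ 0) : w ^ 2 * (a * b * T / (κ * κ')) =
      a / u * (T * (u * w / κ * (w * v / κ')) * (b / v)) := by
  field_simp

/-- In `hess_nonpos` the second derivative is a sum over the middle index `l` with factor `w l ^ 2`.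
Taking `v i = b i * d i / w i` makes the remaining factors `S l` independent of `w`, and
orthogonality to `w` becomes the condition `hb`. A large `w k` forces `S k ≤ 0`, and the factors `d
i` cancel the denominators of `S k`. -/
lemma ker_sum_nonneg (r f : ℝ[X]) {ε : ℝ}
    (hconv : ∀ A : Matrix (Fin n) (Fin n) ℝ, A.IsSymm →
      Convex ℝ (NCPoly.crossSection (slicePoly r f) A ∩ symmBall n ε))
    (x g : Fin n → ℝ) (hg : ∀ i, g i * r.eval (x i) = f.eval (x i))
    (hε : 0 < ε) (hx : ∀ i, |x i| < ε) (hr : ∀ i, 0 < r.eval (x i))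
    (hk : ∀ i j, kap r f x g i j ≠ 0) (k : Fin n) (b : Fin n → ℝ)
    (hb : ∑ i, b i * (den r (f - C (g k) * r) (x k)).eval (x i) = 0) :
    0 ≤ ∑ i, ∑ j, b i * b j * (ker r (f - C (g k) * r) (x k) (x i)).eval (x j) := by
  set d : Fin n → ℝ := fun i => (den r (f - C (g k) * r) (x k)).eval (x i) with hd
  set T : Fin n → Fin n → Fin n → ℝ := fun l i j =>
    (dq (dq r (x l)) (x i)).eval (x j) * (g i + g j)
        - 2 * (dq (dq f (x l)) (x i)).eval (x j) with hT
  set S : Fin n → ℝ := fun l => ∑ i, ∑ j, b i * d i * (b j * d j) * T l i j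
    / (kap r f x g i l * kap r f x g l j) with hS
  have hSk : S k = -∑ i, ∑ j, b i * b j * (ker r (f - C (g k) * r) (x k) (x i)).eval (x j) := by
    simp only [hS, ← Finset.sum_neg_distrib]
    refine Finset.sum_congr rfl fun i _ => Finset.sum_congr rfl fun j _ => ?_
    have hi : d i = -(r.eval (x i) * kap r f x g i k) := by rw [kap_mul r f x g hg]; simp [hd]
    have hj : d j = -(r.eval (x j) * kap r f x g k j) := by
      rw [kap_comm, kap_mul r f x g hg]; simp [hd]
    rw [ker_eval r f x g hg, hi, hj, div_eq_iff (mul_ne_zero (hk _ _) (hk _ _))]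
    ring
  have key (W : ℝ) (hW : W ≠ 0) : W ^ 2 * S k + ∑ l ∈ Finset.univ.erase k, S l ≤ 0 := by
    set w : Fin n → ℝ := fun i => if i = k then W else 1 with hw
    have hw0 (i : Fin n) : w i ≠ 0 := by simp only [hw]; split_ifs <;> simp [hW]
    have h := hess_nonpos r f hconv x g w (fun i => b i * d i / w i) hg hε hx hr hk (by
      rw [← hb, dotProduct]
      exact Finset.sum_congr rfl fun i _ => mul_div_cancel₀ (b i * d i) (hw0 i))
    refine le_of_eq_of_le ?_ h
    have e1 : W ^ 2 * S k + ∑ l ∈ Finset.univ.erase k, S l = ∑ l, w l ^ 2 * S l := by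
      rw [← Finset.add_sum_erase _ _ (Finset.mem_univ k)]
      congr 1
      · simp [hw]
      · refine Finset.sum_congr rfl fun l hl => ?_
        simp [hw, Finset.ne_of_mem_erase hl]
    have e2 (l : Fin n) : w l ^ 2 * S l = ∑ i, ∑ j, b i * d i / w i * (T l i j *
        (w i * w l / kap r f x g i l * (w l * w j / kap r f x g l j)) * (b j * d j / w j)) := by
      simp only [hS, Finset.mul_sum]
      exact Finset.sum_congr rfl fun i _ => Finset.sum_congr rfl fun j _ =>
        cancel_weights _ _ _ _ (hw0 i) (hw0 j) (hk i l) (hk l j)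
    rw [e1]
    simp only [dotProduct, mulVec, hess_apply, of_apply, Finset.mul_sum, Finset.sum_mul]
    rw [Finset.sum_congr rfl fun l _ => e2 l, Finset.sum_comm]
    refine Finset.sum_congr rfl fun i _ => ?_
    rw [Finset.sum_comm]
  by_contra! hneg
  have hpos : 0 < S k := by rw [hSk]; linarith
  -- With `W² = |c| / S k + 1` the left side of `key` equals `|c| + S k + c > 0`.
  set c := ∑ l ∈ Finset.univ.erase k, S l
  have hq : 0 < |c| / S k + 1 :=
    add_pos_of_nonneg_of_pos (div_nonneg (abs_nonneg _) hpos.le) one_pos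
  have h := key _ (Real.sqrt_pos.2 hq).ne'
  rw [Real.sq_sqrt hq.le, add_mul, div_mul_cancel₀ _ hpos.ne'] at h
  linarith [neg_abs_le c]

/-- Lagrange interpolation: the weights are the values of `μ` on the basis polynomials. -/
lemma exists_weights {N : ℕ} {x : Fin N → ℝ} (hx : Function.Injective x) (μ : ℝ[X] →ₗ[ℝ] ℝ) :
    ∃ b : Fin N → ℝ, ∀ q : ℝ[X], q.degree < N → ∑ i, b i * q.eval (x i) = μ q := by
  refine ⟨fun i => μ (Lagrange.basis Finset.univ x i), fun q hq => ?_⟩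
  have h := Lagrange.eq_interpolate (s := Finset.univ) (v := x) (f := q) hx.injOn (by simpa using hq)
  nth_rewrite 2 [h]
  rw [Lagrange.interpolate_apply, map_sum]
  refine Finset.sum_congr rfl fun i _ => ?_
  rw [← smul_eq_C_mul, map_smul, smul_eq_mul, mul_comm]

/-- The test functional is evaluation at `s` plus `τ` times the coefficient of degree `M`, corrected
by a multiple of the coefficient of degree `M + 1`. The correction makes it annihilate `D` and is
invisible to the kernel, whose degree is at most `M`. Applying the functional in both variables
gives the quadratic in `τ`. -/
lemma kernel_top_coeff_nonneg {M : ℕ} {x : Fin (M + 2) → ℝ} (hx : Function.Injective x)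
    (P : ℝ → ℝ[X]) (D c : ℝ[X]) (hP : ∀ s t, (P s).eval t = (P t).eval s)
    (hPd : ∀ s, (P s).natDegree ≤ M) (hc : ∀ s, (P s).coeff M = c.eval s)
    (hcd : c.natDegree ≤ M) (hD : D.natDegree ≤ M + 1) (hD0 : D.coeff (M + 1) ≠ 0)
    (hpsd : ∀ b : Fin (M + 2) → ℝ, ∑ i, b i * D.eval (x i) = 0 →
      0 ≤ ∑ i, ∑ j, b i * b j * (P (x i)).eval (x j)) (s τ : ℝ) :
    0 ≤ (P s).eval s + 2 * τ * c.eval s + τ ^ 2 * c.coeff M := by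
  set κ := (D.eval s + τ * D.coeff M) / D.coeff (M + 1) with hκ
  obtain ⟨b, hb⟩ := exists_weights hx (leval s + τ • lcoeff ℝ M - κ • lcoeff ℝ (M + 1))
  have hdeg {q : ℝ[X]} (hq : q.natDegree ≤ M + 1) : q.degree < ((M + 2 : ℕ) : WithBot ℕ) :=
    (degree_le_of_natDegree_le hq).trans_lt (by exact_mod_cast Nat.lt_succ_self _)
  have hlow {q : ℝ[X]} (hq : q.natDegree ≤ M) :
      ∑ i, b i * q.eval (x i) = q.eval s + τ * q.coeff M := by
    rw [hb q (hdeg (by omega))]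
    simp [leval, coeff_eq_zero_of_natDegree_lt (by omega : q.natDegree < M + 1)]
  have h := hpsd b (by
    rw [hb D (hdeg hD)]
    simp [leval, hκ, hD0])
  have e (i : Fin (M + 2)) : ∑ j, b i * b j * (P (x i)).eval (x j)
      = b i * (P s).eval (x i) + τ * (b i * c.eval (x i)) := by
    simp only [mul_assoc, ← Finset.mul_sum]
    rw [hlow (hPd _), hP, hc]; ring
  simp only [e, Finset.sum_add_distrib, ← Finset.mul_sum] at h
  rw [hlow (hPd s), hlow hcd, hc] at h
  linarith

end NCSlice

/-! ### Nodes near 0 in general position. -/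

namespace NCSlice

/-- Compare multiplicities of the root 0: it is one less in `f'` than in `f`, while `r` does not
vanish there. -/
lemma wronskian_ne_zero {r f : ℝ[X]} (hr : r.eval 0 = 1) (hf : f.eval 0 = 0) (hf0 : f ≠ 0) :
    derivative f * r - f * derivative r ≠ 0 := by
  intro h
  rw [sub_eq_zero] at h
  have hr0 : r ≠ 0 := by rintro rfl; simp at hr
  have hm : 0 < rootMultiplicity 0 f := (rootMultiplicity_pos hf0).2 hf
  have hf' : derivative f ≠ 0 := fun h0 => by
    have := derivative_eq_zero.1 h0
    rw [eq_C_of_natDegree_eq_zero this] at hf hf0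
    simp at hf; simp [hf] at hf0
  have hl : derivative f * r ≠ 0 := mul_ne_zero hf' hr0
  have h1 := congrArg (rootMultiplicity 0) h
  rw [rootMultiplicity_mul hl, rootMultiplicity_mul (h ▸ hl),
    derivative_rootMultiplicity_of_root hf,
    rootMultiplicity_eq_zero (p := r) (by simp [IsRoot, hr])] at h1
  omega

open Filter Topology in
lemma eventually_eval_ne_zero {q : ℝ[X]} (hq : q ≠ 0) : ∀ᶠ x in 𝓝[>] (0 : ℝ), q.eval x ≠ 0 := by
  have h : ∀ᶠ x in 𝓝[≠] (0 : ℝ), x ∉ (q.roots.toFinset : Set ℝ) :=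
    ((q.roots.toFinset.finite_toSet.subset Set.sdiff_subset).isClosed.isOpen_compl.mem_nhds
      (by simp : (0 : ℝ) ∈ ((q.roots.toFinset : Set ℝ) \ {0})ᶜ)) |>
      fun h => by
        filter_upwards [mem_nhdsWithin_of_mem_nhds h, self_mem_nhdsWithin] with x hx h0 hxr
        exact hx ⟨hxr, h0⟩
  filter_upwards [h.filter_mono (nhdsWithin_mono 0 fun x (hx : 0 < x) => hx.ne')] with x hx h0
  exact hx (by simpa [hq] using h0)

/-- By Rolle, equal values of `f/r` would produce a zero of the Wronskian. -/
lemma quotient_ne {r f : ℝ[X]} {δ : ℝ} (hpos : ∀ y ∈ Set.Ioo 0 δ, 0 < r.eval y)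
    (hw : ∀ y ∈ Set.Ioo 0 δ, (derivative f * r - f * derivative r).eval y ≠ 0) {x y : ℝ}
    (hx : x ∈ Set.Ioo 0 δ) (hy : y ∈ Set.Ioo 0 δ) (hxy : x < y) :
    f.eval x / r.eval x ≠ f.eval y / r.eval y := by
  intro h
  have hmem {t : ℝ} (ht : t ∈ Set.Icc x y) : t ∈ Set.Ioo 0 δ :=
    ⟨hx.1.trans_le ht.1, ht.2.trans_lt hy.2⟩
  obtain ⟨c, hc, hd⟩ := exists_deriv_eq_zero hxy (f := fun t => f.eval t / r.eval t)
    (f.continuous.continuousOn.div r.continuous.continuousOn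
      fun t ht => (hpos t (hmem ht)).ne') h
  have hcm := hmem (Set.Ioo_subset_Icc_self hc)
  have hrc := (hpos c hcm).ne'
  rw [((f.hasDerivAt c).fun_div (r.hasDerivAt c) hrc).deriv, div_eq_zero_iff] at hd
  refine hw c hcm ?_
  simpa [hrc] using hd

open Filter Topology in
/-- There are arbitrarily many points near `0` in general position for `r` and `f`. -/
lemma exists_points {r f : ℝ[X]} (hr : r.eval 0 = 1) (hf : f.eval 0 = 0) (hf0 : f ≠ 0)
    {q : ℝ[X]} (hq : q ≠ 0) {ε : ℝ} (hε : 0 < ε) (N : ℕ) :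
    ∃ x : Fin N → ℝ, Function.Injective x ∧ (∀ i, |x i| < ε) ∧ (∀ i, 0 < r.eval (x i)) ∧
      (∀ i, q.eval (x i) ≠ 0) ∧
      ∀ i j, kap r f x (fun i => f.eval (x i) / r.eval (x i)) i j ≠ 0 := by
  have h1 : ∀ᶠ x in 𝓝[>] (0 : ℝ), 0 < r.eval x :=
    ((r.continuous.tendsto 0).eventually_const_lt (by simp [hr])).filter_mono nhdsWithin_le_nhds
  obtain ⟨δ, hδ, h⟩ := (nhdsGT_basis (0 : ℝ)).eventually_iff.1
    (h1.and ((eventually_eval_ne_zero hq).and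
      (eventually_eval_ne_zero (wronskian_ne_zero hr hf hf0))))
  set x : Fin N → ℝ := fun i => min δ ε / ((i : ℕ) + 2) with hx
  have hm : 0 < min δ ε := lt_min hδ hε
  have hx0 (i) : 0 < x i := by simp only [hx]; positivity
  have hxm (i) : x i < min δ ε := by
    simp only [hx]
    exact div_lt_self hm (by have : (0 : ℝ) ≤ (i : ℕ) := Nat.cast_nonneg _; linarith)
  have hxδ (i) : x i ∈ Set.Ioo 0 δ := ⟨hx0 i, (hxm i).trans_le (min_le_left _ _)⟩
  have hinj : Function.Injective x := fun i j hij => by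
    simp only [hx] at hij
    have h2 : ((i : ℕ) : ℝ) + 2 = (j : ℕ) + 2 := by
      field_simp at hij
      linarith
    exact Fin.ext (by exact_mod_cast add_right_cancel h2)
  have hrpos (i) := (h (hxδ i)).1
  refine ⟨x, hinj, fun i => ?_, hrpos, fun i => (h (hxδ i)).2.1, fun i j h0 => ?_⟩
  · rw [abs_of_pos (hx0 i)]; exact (hxm i).trans_le (min_le_right _ _)
  · set g : Fin N → ℝ := fun i => f.eval (x i) / r.eval (x i) with hg
    have hgi (i) : g i * r.eval (x i) = f.eval (x i) := div_mul_cancel₀ _ (hrpos i).ne'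
    have h2 := kap_mul r f x g hgi i j
    rw [h0, mul_zero, eq_comm, neg_eq_zero, den, eval_mul, mul_eq_zero] at h2
    rcases h2 with h2 | h2
    · rw [eval_add, eval_C] at h2
      linarith [hrpos i, hrpos j]
    -- On the diagonal a zero of `kap` is a zero of the Wronskian; off the diagonal it is a
    -- coincidence of values of `f/r`.
    · rcases eq_or_ne i j with rfl | hij
      · rw [dq_sub_C_mul, eval_sub, eval_mul, eval_C, eval_dq_self, eval_dq_self] at h2
        refine (h (hxδ i)).2.2 ?_
        simp only [eval_sub, eval_mul, ← hgi i]
        linear_combination (r.eval (x i)) * h2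
      · have h3 := sub_mul_eval_dq (f - C (g j) * r) (x j) (x i)
        rw [h2, mul_zero, eval_sub, eval_sub, eval_mul, eval_mul, eval_C, eval_C, hgi j, sub_self,
          sub_zero, ← hgi i, ← sub_mul, eq_comm, mul_eq_zero, sub_eq_zero] at h3
        have h4 : g i = g j := h3.resolve_right (hrpos i).ne'
        have hp := fun y hy => (h (x := y) hy).1
        have hw := fun y hy => (h (x := y) hy).2.2
        rcases lt_or_gt_of_ne (hinj.ne hij) with hlt | hlt
        · exact quotient_ne hp hw (hxδ i) (hxδ j) hlt h4
        · exact quotient_ne hp hw (hxδ j) (hxδ i) hlt h4.symm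

/-! ### Degree bounds from the top coefficient of the kernel. -/

lemma quadratic_nonneg {a b e : ℝ} (h : ∀ τ : ℝ, 0 ≤ a + 2 * τ * b + τ ^ 2 * e) :
    0 ≤ e ∧ (e = 0 → b = 0) := by
  have hd := discrim_le_zero (a := e) (b := 2 * b) (c := a) fun τ => by linarith [h τ]
  rw [discrim] at hd
  have h0 := h 0
  have h1 := h 1
  have h2 := h (-1)
  constructor
  · by_contra! he
    have : b ^ 2 ≤ 0 := by nlinarith
    have hb : b = 0 := by nlinarith
    have ha : a = 0 := by subst hb; nlinarith
    subst hb ha; linarith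
  · rintro rfl
    nlinarith

lemma dq_dq_eq_zero {r : ℝ[X]} (h : r.natDegree ≤ 1) (z x : ℝ) : dq (dq r z) x = 0 := by
  rw [eq_C_of_natDegree_eq_zero (p := dq r z) (by rw [natDegree_dq]; omega), dq_C]

/-- Both cases apply `kernel_top_coeff_nonneg` with `M = k + m`. For `k ≤ 1` the second divided
difference of `r` vanishes and the top coefficient of the kernel is a nonzero multiple of `r`. For
`k ≥ 2` it is a nonzero multiple of `q`, a combination of `r` and `F` whose coefficient of degree `k
+ m` vanishes; then `q` vanishes everywhere, against `hind`. -/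
lemma degree_bounds_of_ker {r F : ℝ[X]} {z : ℝ} {k m : ℕ} (hk : r.natDegree = k) (hz : 0 < r.eval z)
    (hF : F.natDegree ≤ m + 2) (hF0 : F.coeff (m + 2) ≠ 0) (hrm : k ≤ m + 2)
    (hind : C (F.coeff (m + 2)) * r - C (r.coeff (m + 2)) * F ≠ 0)
    {x : Fin (k + m + 2) → ℝ} (hx : Function.Injective x)
    (hpsd : ∀ b : Fin (k + m + 2) → ℝ, ∑ i, b i * (den r F z).eval (x i) = 0 →
      0 ≤ ∑ i, ∑ j, b i * b j * (ker r F z (x i)).eval (x j)) :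
    k ≤ 1 ∧ m = 0 ∧ 0 ≤ F.coeff 2 := by
  have hr0 : r ≠ 0 := by rintro rfl; simp at hz
  have hlc : r.coeff k ≠ 0 := hk ▸ leadingCoeff_ne_zero.2 hr0
  have hdF (s : ℝ) : (dq (dq F z) s).natDegree ≤ m := by
    rw [natDegree_dq, natDegree_dq]; omega
  have hdFc (s : ℝ) : (dq (dq F z) s).coeff m = F.coeff (m + 2) := by
    rw [coeff_dq (by rw [natDegree_dq]; omega), coeff_dq hF]
  have hfirst (s : ℝ) : (C (2 * r.eval s) * (r * dq (dq F z) s)).natDegree ≤ k + m :=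
    (natDegree_C_mul_le _ _).trans (natDegree_mul_le_of_le hk.le (hdF s))
  have hfirstc (s : ℝ) : (C (2 * r.eval s) * (r * dq (dq F z) s)).coeff (k + m)
      = 2 * r.eval s * (r.coeff k * F.coeff (m + 2)) := by
    rw [coeff_C_mul, coeff_mul_add_eq_of_natDegree_le hk.le (hdF s), hdFc]
  have hden : (den r F z).natDegree ≤ k + m + 1 :=
    natDegree_mul_le_of_le (n := m + 1) (natDegree_add_C.le.trans hk.le) (by rw [natDegree_dq]; omega)
  have hden0 : (den r F z).coeff (k + m + 1) ≠ 0 := by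
    rw [den, add_assoc, coeff_mul_add_eq_of_natDegree_le (natDegree_add_C.le.trans hk.le)
      (by rw [natDegree_dq]; omega), coeff_dq hF]
    refine mul_ne_zero ?_ hF0
    rw [coeff_add, coeff_C]
    -- For constant `r` the added constant doubles the leading coefficient instead of leaving it
    -- unchanged.
    split_ifs with h
    · rw [eq_C_of_natDegree_eq_zero (hk.trans h), eval_C] at hz
      rw [eq_C_of_natDegree_eq_zero (hk.trans h), eval_C, h, coeff_C_zero]
      linarith
    · rwa [add_zero]
  have main := kernel_top_coeff_nonneg hx (ker r F z) (den r F z)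
  by_cases hk1 : k ≤ 1
  · have hker (s : ℝ) : ker r F z s = C (2 * r.eval s) * (r * dq (dq F z) s) := by
      rw [ker, dq_dq_eq_zero (hk.trans_le hk1), zero_mul, sub_zero]
    have h := fun hd => main (C (2 * (r.coeff k * F.coeff (m + 2))) * r) (ker_comm r F z)
      (fun s => hker s ▸ hfirst s) (fun s => by
        rw [hker, hfirstc, eval_mul, eval_C]; ring) hd hden hden0 hpsd z
    have h := quadratic_nonneg (h ((natDegree_C_mul_le _ _).trans (by omega)))
    -- If `m > 0`, the `τ²` coefficient vanishes because `deg r < k + m`, while the linear one is a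
    -- nonzero multiple of `r(z)`.
    have hm : m = 0 := by
      by_contra hm
      have h1 := h.2 (by
        rw [coeff_C_mul, coeff_eq_zero_of_natDegree_lt (p := r) (n := k + m) (by omega), mul_zero])
      rw [eval_mul, eval_C] at h1
      exact mul_ne_zero (mul_ne_zero two_ne_zero (mul_ne_zero hlc hF0)) hz.ne' h1
    subst hm
    refine ⟨hk1, rfl, ?_⟩
    have h1 := h.1
    rw [coeff_C_mul, add_zero, zero_add] at h1
    have h2 : 0 < r.coeff k ^ 2 := by positivity
    by_contra! hneg
    nlinarith
  · exfalso
    push Not at hk1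
    obtain ⟨l, hl⟩ : ∃ l, k = l + 2 := ⟨k - 2, by omega⟩
    have hdr (s : ℝ) : (dq (dq r z) s).natDegree ≤ l := by
      rw [natDegree_dq, natDegree_dq]; omega
    have hdrc (s : ℝ) : (dq (dq r z) s).coeff l = r.coeff k := by
      rw [coeff_dq (by rw [natDegree_dq]; omega), coeff_dq (by omega), hl]
    have hsum (s : ℝ) : (C (F.eval s) * r + C (r.eval s) * F).natDegree ≤ m + 2 :=
      natDegree_add_le_of_degree_le ((natDegree_C_mul_le _ _).trans (hk.trans_le hrm))
        ((natDegree_C_mul_le _ _).trans hF)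
    have hkm : k + m = l + (m + 2) := by omega
    set q := C (F.coeff (m + 2)) * r - C (r.coeff (m + 2)) * F with hq
    have hqd : q.natDegree ≤ m + 2 :=
      (natDegree_sub_le_of_le (natDegree_C_mul_le _ _) (natDegree_C_mul_le _ _)).trans
        (max_le (hk.trans_le hrm) hF)
    have h := fun s => main (C (r.coeff k) * q) (ker_comm r F z)
      (fun s => by
        refine (natDegree_sub_le_of_le (hfirst s)
          (natDegree_mul_le_of_le (hdr s) (hsum s))).trans ?_
        rw [hkm, max_self])
      (fun s => by
        rw [ker, coeff_sub, hfirstc, hkm,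
          coeff_mul_add_eq_of_natDegree_le (hdr s) (hsum s), hdrc, coeff_add, coeff_C_mul,
          coeff_C_mul, hq, eval_mul, eval_C, eval_sub, eval_mul, eval_mul, eval_C, eval_C]
        ring) ((natDegree_C_mul_le _ _).trans (by omega)) hden hden0 hpsd s
    have hq0 : q.coeff (k + m) = 0 := by
      -- For `l = 0` the degree in question is `m + 2`, where the two terms of `q` cancel; otherwise
      -- it exceeds the degree of `q`.
      rcases Nat.eq_zero_or_pos l with h0 | h0
      · rw [hkm, h0, zero_add, hq, coeff_sub, coeff_C_mul, coeff_C_mul]; ring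
      · exact coeff_eq_zero_of_natDegree_lt (by omega)
    refine mul_ne_zero (C_ne_zero.2 hlc) hind (Polynomial.funext fun s => ?_)
    rw [eval_zero]
    exact (quadratic_nonneg (h s)).2 (by rw [coeff_C_mul, hq0, mul_zero])

lemma degree_bounds {r f : ℝ[X]} (hr : r.eval 0 = 1) (hf : f.eval 0 = 0) (hf0 : f ≠ 0) {ε : ℝ}
    (hε : 0 < ε)
    (hconv : ∀ n : ℕ, 0 < n → ∀ A : Matrix (Fin n) (Fin n) ℝ, A.IsSymm →
      Convex ℝ (NCPoly.crossSection (slicePoly r f) A ∩ symmBall n ε)) :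
    r.natDegree ≤ 1 ∧ f.natDegree ≤ 2 ∧ 0 ≤ f.coeff 2 := by
  rcases le_or_gt (max f.natDegree r.natDegree) 1 with hm | hm
  · rw [max_le_iff] at hm
    exact ⟨hm.2, by omega, (coeff_eq_zero_of_natDegree_lt (by omega)).ge⟩
  obtain ⟨m, hmm⟩ : ∃ m, max f.natDegree r.natDegree = m + 2 :=
    ⟨max f.natDegree r.natDegree - 2, by omega⟩
  have hfm : f.natDegree ≤ m + 2 := hmm ▸ le_max_left _ _
  have hrm : r.natDegree ≤ m + 2 := hmm ▸ le_max_right _ _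
  have hr0 : r ≠ 0 := by rintro rfl; simp at hr
  -- Evaluation at 0 gives `f.coeff (m + 2) = 0`, hence also `r.coeff (m + 2) = 0`; but one of the
  -- two is a leading coefficient.
  have hq : C (r.coeff (m + 2)) * f - C (f.coeff (m + 2)) * r ≠ 0 := fun h => by
    have h1 := congrArg (eval 0) h
    simp only [eval_sub, eval_mul, eval_C, hr, hf, eval_zero] at h1
    have h2 : f.coeff (m + 2) = 0 := by linarith
    rw [h2, C_0, zero_mul, sub_zero] at h
    have h3 : r.coeff (m + 2) = 0 := by simpa [hf0] using h
    rcases max_choice f.natDegree r.natDegree with h4 | h4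
    · rw [← hmm, h4] at h2
      exact leadingCoeff_ne_zero.2 hf0 h2
    · rw [← hmm, h4] at h3
      exact leadingCoeff_ne_zero.2 hr0 h3
  obtain ⟨x, hinj, hxε, hrpos, hxq, hkap⟩ :=
    exists_points hr hf hf0 hq hε (r.natDegree + m + 2)
  set g : Fin (r.natDegree + m + 2) → ℝ := fun i => f.eval (x i) / r.eval (x i) with hg
  have hgi (i) : g i * r.eval (x i) = f.eval (x i) := div_mul_cancel₀ _ (hrpos i).ne'
  set F := f - C (g 0) * r with hF
  -- Up to the factor `-r(x 0)` this coefficient is the value at `x 0` of the polynomial in `hq`,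
  -- whose zeros the nodes avoid.
  have hFm : F.coeff (m + 2) ≠ 0 := fun h => hxq 0 <| by
    rw [hF, coeff_sub, coeff_C_mul] at h
    simp only [eval_sub, eval_mul, eval_C, ← hgi 0]
    linear_combination (-r.eval (x 0)) * h
  have hFd : F.natDegree ≤ m + 2 :=
    (natDegree_sub_le_of_le hfm ((natDegree_C_mul_le _ _).trans hrm)).trans (max_self _).le
  have hind : C (F.coeff (m + 2)) * r - C (r.coeff (m + 2)) * F ≠ 0 := fun h => hq <| by
    rw [← neg_eq_zero, ← h, hF, coeff_sub, coeff_C_mul, C_sub, C_mul]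
    ring
  obtain ⟨h1, rfl, h2⟩ := degree_bounds_of_ker rfl (hrpos 0) hFd hFm hrm hind hinj fun b hb =>
    ker_sum_nonneg r f (hconv _ (by omega)) x g hgi hε hxε hrpos hkap 0 b hb
  refine ⟨h1, hfm, ?_⟩
  rwa [hF, coeff_sub, coeff_C_mul, coeff_eq_zero_of_natDegree_lt (p := r) (by omega), mul_zero,
    sub_zero] at h2

end NCSlice

/-! ### The explicit representation. -/

theorem theorem1 (r f : ℝ[X])
    (hr : r.eval 0 = 1) (hf : f.eval 0 = 0)
    (hfr : ¬ ∃ c : ℝ, algebraMap ℝ[X] (RatFunc ℝ) f * (algebraMap ℝ[X] (RatFunc ℝ) r)⁻¹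
      = RatFunc.C c)
    (hconv : ∃ ε : ℝ, 0 < ε ∧ ∀ n : ℕ, 0 < n → ∀ A : Matrix (Fin n) (Fin n) ℝ, A.IsSymm →
      Convex ℝ (NCPoly.crossSection (slicePoly r f) A ∩ symmBall n ε)) :
    (∃ (l : NCPoly) (N : ℕ) (s : Fin N → NCPoly),
      star l = l ∧ l ∈ NCPoly.affineInX ∧
      (∀ j, s j ∈ NCPoly.linearInX ∧ s j ∈ NCPoly.indepOfA) ∧
      slicePoly r f = l - ∑ j, star (s j) * s j) ∧
    f.natDegree ≤ 2 := by
  have hf0 : f ≠ 0 := by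
    rintro rfl
    exact hfr ⟨0, by simp⟩
  obtain ⟨ε, hε, hc⟩ := hconv
  obtain ⟨h1, h2, h3⟩ := NCSlice.degree_bounds hr hf hf0 hε hc
  refine ⟨?_, h2⟩
  have hr1 : r = C 1 + C (r.coeff 1) * X := by
    have h := eq_X_add_C_of_natDegree_le_one h1
    rw [coeff_zero_eq_eval_zero, hr, add_comm] at h
    exact h
  have hf1 : f = C (f.coeff 2) * X ^ 2 + C (f.coeff 1) * X := by
    have h := eq_quadratic_of_degree_le_two (p := f) (natDegree_le_iff_degree_le.1 h2)
    rwa [coeff_zero_eq_eval_zero, hf, C_0, add_zero] at h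
  generalize r.coeff 1 = ρ at hr1
  generalize f.coeff 2 = β at hf1 h3
  generalize f.coeff 1 = α at hf1
  subst hr1 hf1
  set a := NCPoly.varA with ha
  set x := NCPoly.varX with hx
  have hsa : star a = a := FreeAlgebra.star_ι _
  have hsx : star x = x := FreeAlgebra.star_ι _
  have hss (c : ℝ) (p : NCPoly) : star (c • p) = c • star p := by
    rw [Algebra.smul_def, star_mul, FreeAlgebra.star_algebraMap, Algebra.smul_def,
      Algebra.commutes]
  have hword (w : List NCVar) (hw : w.count NCVar.x ≤ 1) :
      NCPoly.word w ∈ NCPoly.affineInX := Submodule.subset_span ⟨w, hw, rfl⟩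
  have hA : a ∈ NCPoly.affineInX := by
    simpa [NCPoly.word, ha, hx, NCPoly.varA, NCPoly.varX] using hword [NCVar.a] (by decide)
  have hX : x ∈ NCPoly.affineInX := by
    simpa [NCPoly.word, ha, hx, NCPoly.varA, NCPoly.varX] using hword [NCVar.x] (by decide)
  have hAX : a * x ∈ NCPoly.affineInX := by
    simpa [NCPoly.word, ha, hx, NCPoly.varA, NCPoly.varX] using hword [NCVar.a, NCVar.x] (by decide)
  have hXA : x * a ∈ NCPoly.affineInX := by
    simpa [NCPoly.word, ha, hx, NCPoly.varA, NCPoly.varX] using hword [NCVar.x, NCVar.a] (by decide)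
  -- With `r = 1 + ρx` and `f = βx² + αx`, the only part not affine in `x` is `-2βx²`; since `β ≥
  -- 0`, it is minus a single square.
  refine ⟨(2 : ℝ) • a + ρ • (x * a) + ρ • (a * x) - (2 * α) • x, 1,
    fun _ => Real.sqrt (2 * β) • x, ?_, ?_, fun _ => ⟨?_, ?_⟩, ?_⟩
  · simp only [star_add, star_sub, hss, star_mul, hsa, hsx]
    abel
  · exact Submodule.sub_mem _ (Submodule.add_mem _ (Submodule.add_mem _
      (Submodule.smul_mem _ _ hA) (Submodule.smul_mem _ _ hXA)) (Submodule.smul_mem _ _ hAX))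
      (Submodule.smul_mem _ _ hX)
  · exact Submodule.smul_mem _ _ (Submodule.subset_span
      ⟨[NCVar.x], by decide, by simp [NCPoly.word, hx, NCPoly.varX]⟩)
  · exact Submodule.smul_mem _ _ (Submodule.subset_span
      ⟨[NCVar.x], by decide, by simp [NCPoly.word, hx, NCPoly.varX]⟩)
  · have hsq : Real.sqrt (2 * β) * Real.sqrt (2 * β) = 2 * β :=
      Real.mul_self_sqrt (by positivity)
    simp only [slicePoly, Finset.univ_unique, Finset.sum_const, Finset.card_singleton, one_smul,
      hss, hsx, smul_mul_assoc, mul_smul_comm, smul_smul, hsq, map_add, map_mul, aeval_X, aeval_C,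
      map_one, ← Algebra.smul_def, ← ha, ← hx, add_mul, mul_add, one_mul, mul_one, pow_two]
    module
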